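/- **Proposition (injectivity of the sampling map).** For $\Lambda>0$ and $s\in\mathbb N$ let $$S_{[0,\Lambda],s}=\Bigl\{\sum_{j=1}^{s}c_j\delta_{t_j} : c\in\mathbb C^s,\ 0\le t_1<t_2<\dots<t_s\le\Lambda\Bigr\}$$ be the set of complex linear combinations of Dirac measures on $\mathbb R$ supported on at most $s$ points of $[0,\Lambda]$, and let $\hat\mu(\omega)=\int e^{-2\pi i\omega t}\,d\mu(t)$ denote the Fourier transform of a complex measure $\mu$ on $\mathbb R$, so that $\hat\mu(\omega)=\sum_{j=1}^{s}c_je^{-2\pi i\omega t_j}$ for $\mu=\sum_{j=1}^s c_j\delta_{t_j}$. Let $\Lambda,\Omega>0$, let $s\in\mathbb N$ satisfy $2s>\Lambda\Omega$, let $$n>\Bigl(2+\frac{12}{\ln\bigl(2s/(\Lambda\Omega)\bigr)}\Bigr)s,$$ and let $v_1,\dots,v_n$ be pairwise distinct points of $[-\Omega,\Omega]$. Then the linear map $\phi_v:\mu\mapsto(\hat\mu(v_j))_{j=1}^n$ is injective on $S_{[0,\Lambda],s}$: if $\mu_1,\mu_2\in S_{[0,\Lambda],s}$ and $\hat\mu_1(v_j)=\hat\mu_2(v_j)$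 for all $j$, then $\mu_1=\mu_2$. -/

import Mathlib

open MeasureTheory

noncomputable section

namespace SparseSampling

/-- The (normalized) Dirac measure at `t`, as a complex measure on the real line. -/
def diracMeasure (t : ℝ) : ComplexMeasure ℝ := VectorMeasure.dirac t 1

/-- `sparseMeasures Λ s` is the set of complex combinations of `s` Dirac measures located at
points `0 ≤ t₁ < ⋯ < tₛ ≤ Λ`. The coefficients may vanish, so that the support has at most
`s` points. -/
def sparseMeasures (Λ : ℝ) (s : ℕ) : Set (ComplexMeasure ℝ) :=
  {μ | ∃ (c : Fin s → ℂ) (t : Fin s → ℝ), StrictMono t ∧ (∀ j, t j ∈ Set.Icc 0 Λ) ∧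
    μ = ∑ j, c j • diracMeasure (t j)}

/-- The Fourier transform `ω ↦ ∫ exp (-2πiωt) dμ(t)` of a complex measure on the real line. -/
def fourierTransform (μ : ComplexMeasure ℝ) (ω : ℝ) : ℂ :=
  VectorMeasure.integral μ (fun t : ℝ => Complex.exp (-2 * Real.pi * Complex.I * ω * t))
    (ContinuousLinearMap.mul ℝ ℂ)

theorem isFiniteMeasure_variation (μ : ComplexMeasure ℝ) :
    IsFiniteMeasure (VectorMeasure.variation μ) := by
  have h : VectorMeasure.variation μ ≤
      (ComplexMeasure.re μ).totalVariation + (ComplexMeasure.im μ).totalVariation := by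
    refine VectorMeasure.variation_le_of_forall_enorm_le fun E _ => ?_
    have h1 := (ComplexMeasure.re μ).enorm_le_totalVariation E
    have h2 := (ComplexMeasure.im μ).enorm_le_totalVariation E
    have h3 : ‖μ E‖ₑ ≤ ‖(ComplexMeasure.re μ) E‖ₑ + ‖(ComplexMeasure.im μ) E‖ₑ := by
      have h4 : μ E = (((ComplexMeasure.re μ) E : ℝ) : ℂ)
          + (((ComplexMeasure.im μ) E : ℝ) : ℂ) * Complex.I := (Complex.re_add_im (μ E)).symm
      rw [h4]
      refine (enorm_add_le _ _).trans (add_le_add ?_ ?_)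
      · simp [enorm_eq_nnnorm]
      · simp [enorm_eq_nnnorm]
    exact h3.trans (add_le_add h1 h2)
  exact ⟨(h Set.univ).trans_lt (measure_lt_top _ _)⟩

theorem integrable_character (μ : ComplexMeasure ℝ) (ω : ℝ) :
    VectorMeasure.Integrable μ
      (fun t : ℝ => Complex.exp (-2 * Real.pi * Complex.I * ω * t)) := by
  have := isFiniteMeasure_variation μ
  refine Integrable.of_bound (C := 1) (by fun_prop) (Filter.Eventually.of_forall fun t => ?_)
  rw [Complex.norm_exp]
  simp

theorem integral_smul_measure (μ : ComplexMeasure ℝ) (c : ℂ) {f : ℝ → ℂ}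
    (hf : VectorMeasure.Integrable μ f) :
    VectorMeasure.integral (c • μ) f (ContinuousLinearMap.mul ℝ ℂ) =
      c * VectorMeasure.integral μ f (ContinuousLinearMap.mul ℝ ℂ) := by
  have hvar : VectorMeasure.variation (c • μ) = ‖c‖₊ • VectorMeasure.variation μ := by
    rw [VectorMeasure.variation_smul]
  have hT := dominatedFinMeasAdditive_cbmApplyMeasure μ (ContinuousLinearMap.mul ℝ ℂ)
  have hT' : DominatedFinMeasAdditive (VectorMeasure.variation μ)
      (VectorMeasure.transpose (c • μ) (ContinuousLinearMap.mul ℝ ℂ))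
      (‖ContinuousLinearMap.mul ℝ ℂ‖ * ‖c‖) := by
    refine ⟨fun s t hs ht _ _ hd => VectorMeasure.of_union hd hs ht, fun s hs hfin => ?_⟩
    refine (norm_cbmApplyMeasure_le (c • μ) (ContinuousLinearMap.mul ℝ ℂ) s).trans ?_
    rw [mul_assoc]
    refine mul_le_mul_of_nonneg_left ?_ (by positivity)
    have h1 : (c • μ) s = c * μ s := rfl
    rw [h1, norm_mul]
    exact mul_le_mul_of_nonneg_left (VectorMeasure.norm_measure_le_variation hfin.ne)
      (norm_nonneg _)
  have key : VectorMeasure.integral (c • μ) f (ContinuousLinearMap.mul ℝ ℂ) =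
      setToFun (VectorMeasure.variation μ)
        (VectorMeasure.transpose (c • μ) (ContinuousLinearMap.mul ℝ ℂ)) hT' f := by
    have hD := dominatedFinMeasAdditive_cbmApplyMeasure (c • μ) (ContinuousLinearMap.mul ℝ ℂ)
    have h2 : ∀ (m : Measure ℝ) (_ : m = ‖c‖₊ • VectorMeasure.variation μ)
        (h : DominatedFinMeasAdditive m
          (VectorMeasure.transpose (c • μ) (ContinuousLinearMap.mul ℝ ℂ))
          ‖ContinuousLinearMap.mul ℝ ℂ‖),
        setToFun m (VectorMeasure.transpose (c • μ) (ContinuousLinearMap.mul ℝ ℂ)) h f =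
        setToFun (VectorMeasure.variation μ)
          (VectorMeasure.transpose (c • μ) (ContinuousLinearMap.mul ℝ ℂ)) hT' f := by
      rintro m rfl h
      exact (setToFun_congr_smul_measure' ‖c‖₊ hT' h f).symm
    exact h2 _ hvar hD
  rw [key]
  change _ = c * setToFun (VectorMeasure.variation μ)
    (VectorMeasure.transpose μ (ContinuousLinearMap.mul ℝ ℂ)) hT f
  clear key
  refine Integrable.induction
    (P := fun f => setToFun (VectorMeasure.variation μ)
        (VectorMeasure.transpose (c • μ) (ContinuousLinearMap.mul ℝ ℂ)) hT' f =
      c * setToFun (VectorMeasure.variation μ)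
        (VectorMeasure.transpose μ (ContinuousLinearMap.mul ℝ ℂ)) hT f) ?_ ?_ ?_ ?_ hf
  · intro a s hs hfin
    rw [setToFun_indicator_const hT' hs hfin.ne, setToFun_indicator_const hT hs hfin.ne]
    change a * (c * μ s) = c * (a * μ s)
    ring
  · intro f g _ hf hg h1 h2
    rw [setToFun_add hT' hf hg, setToFun_add hT hf hg, h1, h2, mul_add]
  · exact isClosed_eq (continuous_setToFun hT') (continuous_const.mul (continuous_setToFun hT))
  · intro f g hfg _ h
    rw [← setToFun_congr_ae hT' hfg, ← setToFun_congr_ae hT hfg, h]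

theorem fourierTransform_add (μ ν : ComplexMeasure ℝ) (ω : ℝ) :
    fourierTransform (μ + ν) ω = fourierTransform μ ω + fourierTransform ν ω :=
  VectorMeasure.integral_add_vectorMeasure (integrable_character μ ω) (integrable_character ν ω)

theorem fourierTransform_smul (c : ℂ) (μ : ComplexMeasure ℝ) (ω : ℝ) :
    fourierTransform (c • μ) ω = c * fourierTransform μ ω :=
  integral_smul_measure μ c (integrable_character μ ω)

/-- The linear map that samples the Fourier transform at the points `v₁, …, vₙ`. -/
def samplingMap {n : ℕ} (v : Fin n → ℝ) : ComplexMeasure ℝ →ₗ[ℂ] (Fin n → ℂ) where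
  toFun μ := fun j => fourierTransform μ (v j)
  map_add' μ ν := funext fun j => fourierTransform_add μ ν (v j)
  map_smul' c μ := funext fun j => fourierTransform_smul c μ (v j)

/-- On finite combinations of Dirac measures the Fourier transform is the exponential sum
`∑ cⱼ exp (-2πiωtⱼ)`. -/
theorem fourierTransform_sum_dirac {s : ℕ} (c : Fin s → ℂ) (t : Fin s → ℝ) (ω : ℝ) :
    fourierTransform (∑ j, c j • diracMeasure (t j)) ω =
      ∑ j, c j * Complex.exp (-2 * Real.pi * Complex.I * ω * t j) := by
  have h : fourierTransform (∑ j, c j • diracMeasure (t j)) ω =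
      ∑ j, fourierTransform (c j • diracMeasure (t j)) ω :=
    VectorMeasure.integral_finsetSum_vectorMeasure fun j _ => integrable_character _ ω
  rw [h]
  refine Finset.sum_congr rfl fun j _ => ?_
  rw [fourierTransform_smul, fourierTransform, diracMeasure, VectorMeasure.integral_dirac]
  simp

end SparseSampling

end

/-! The difference of two measures with equal samples has as its Fourier transform an exponential
sum with at most `2s` frequencies in `[0, Λ]`, and this sum vanishes at `n` points of `[-Ω, Ω]`. It
therefore suffices to bound the zeros of a non-trivial exponential sum: `card_zeros_expSum_le` gives
at most `2s + 4ΛΩ` of them, and the hypothesis on `n` exceeds this because `log x ≤ x`.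

Rolle's theorem fails for complex-valued functions, so the curve is projected to a real line, and
sign changes of the projection are averaged over all directions of the line (`meanAlt`). Two
operations control this average. Differentiation lowers it by at most one
(`meanAlt_le_meanAlt_deriv`). Multiplication by a character of frequency `τ ≥ 0` raises it by at
most `2τ(b - a)` (`meanAlt_rotate_le`), since each full turn of the curve meets a given line twice.

Shifting the smallest frequency to zero and differentiating removes one term. Taking frequencies in
increasing order makes the rotation costs telescope to the length of the frequency interval.
Conversely, zeros of the curve force sign changes of almost every projection of its derivative
(`le_meanAlt_deriv_of_zeros`). -/

noncomputable section

namespace SparseSampling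

open Set Filter Topology
open scoped ENNReal

/-! ### Sign changes of real functions on an interval. -/

/-- The points `x 0 < ⋯ < x p` lie in `(a, b)` and `g` changes its sign strictly from each of
them to the next. -/
def Alternates (g : ℝ → ℝ) (a b : ℝ) (p : ℕ) (x : ℕ → ℝ) : Prop :=
  (∀ i ≤ p, x i ∈ Ioo a b) ∧ ∀ i < p, x i < x (i + 1) ∧ g (x i) * g (x (i + 1)) < 0

/-- The number of strict sign changes of `g` on `(a, b)`. -/
def altCount (g : ℝ → ℝ) (a b : ℝ) : ℝ≥0∞ :=
  ⨆ (p : ℕ) (x : ℕ → ℝ) (_ : Alternates g a b p x), (p : ℝ≥0∞)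

theorem Alternates.le_altCount {g : ℝ → ℝ} {a b : ℝ} {p : ℕ} {x : ℕ → ℝ}
    (h : Alternates g a b p x) : (p : ℝ≥0∞) ≤ altCount g a b :=
  le_iSup_of_le p (le_iSup_of_le x (le_iSup_of_le h le_rfl))

theorem altCount_le {g : ℝ → ℝ} {a b : ℝ} {N : ℝ≥0∞}
    (h : ∀ p x, Alternates g a b p x → (p : ℝ≥0∞) ≤ N) : altCount g a b ≤ N :=
  iSup_le fun p => iSup_le fun x => iSup_le fun hx => h p x hx

theorem altCount_const (c a b : ℝ) : altCount (fun _ => c) a b = 0 := by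
  refine le_antisymm (altCount_le fun p x hx => ?_) zero_le
  rcases Nat.eq_zero_or_pos p with rfl | hp
  · simp
  · exact absurd (hx.2 0 hp).2 (not_lt.2 (mul_self_nonneg c))

/-- Rolle's theorem for sign changes. -/
theorem altCount_le_altCount_deriv {g g' : ℝ → ℝ} (hg : ∀ x, HasDerivAt g (g' x) x) (a b : ℝ) :
    altCount g a b ≤ altCount g' a b + 1 := by
  refine altCount_le fun p x hx => ?_
  obtain _ | p := p
  · simp
  have hmv : ∀ i, ∃ ξ, i < p + 1 → (x i < ξ ∧ ξ < x (i + 1) ∧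
      g' ξ * (x (i + 1) - x i) = g (x (i + 1)) - g (x i)) := by
    intro i
    by_cases hi : i < p + 1
    · obtain ⟨ξ, hξ, h⟩ := exists_hasDerivAt_eq_slope g g' (hx.2 i hi).1
        (fun y _ => (hg y).continuousAt.continuousWithinAt) (fun y _ => hg y)
      refine ⟨ξ, fun _ => ⟨hξ.1, hξ.2, ?_⟩⟩
      rw [h, div_mul_cancel₀ _ (sub_pos.2 (hx.2 i hi).1).ne']
    · exact ⟨0, fun h => absurd h hi⟩
  choose ξ hξ using hmv
  have h : Alternates g' a b p ξ := by
    refine ⟨fun i hi => ?_, fun i hi => ?_⟩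
    · obtain ⟨h1, h2, -⟩ := hξ i (by omega)
      exact ⟨(hx.1 i (by omega)).1.trans h1, h2.trans (hx.1 (i + 1) (by omega)).2⟩
    · obtain ⟨h1, h2, h3⟩ := hξ i (by omega)
      obtain ⟨k1, k2, k3⟩ := hξ (i + 1) (by omega)
      refine ⟨h2.trans k1, ?_⟩
      have s1 := (hx.2 i (by omega)).2
      have s2 := (hx.2 (i + 1) (by omega)).2
      have d1 : 0 < x (i + 1) - x i := by linarith
      have d2 : 0 < x (i + 1 + 1) - x (i + 1) := by linarith
      -- Alternating values have alternating increments, and `g'` has the sign of the increment at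
      -- each mean value point.
      have key : (g (x (i + 1)) - g (x i)) * (g (x (i + 1 + 1)) - g (x (i + 1))) < 0 := by
        rcases lt_trichotomy (g (x (i + 1))) 0 with h | h | h
        · have u1 : 0 < g (x i) := by
            by_contra hc
            nlinarith [mul_nonneg_of_nonpos_of_nonpos (not_lt.1 hc) h.le]
          have u2 : 0 < g (x (i + 1 + 1)) := by
            by_contra hc
            nlinarith [mul_nonneg_of_nonpos_of_nonpos (not_lt.1 hc) h.le]
          exact mul_neg_of_neg_of_pos (by linarith) (by linarith)
        · rw [h] at s1; simp at s1
        · have u1 : g (x i) < 0 := by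
            by_contra hc
            nlinarith [mul_nonneg (not_lt.1 hc) h.le]
          have u2 : g (x (i + 1 + 1)) < 0 := by
            by_contra hc
            nlinarith [mul_nonneg (not_lt.1 hc) h.le]
          exact mul_neg_of_pos_of_neg (by linarith) (by linarith)
      rw [← h3, ← k3] at key
      by_contra hc
      have := mul_nonneg (not_lt.1 hc) (mul_pos d1 d2).le
      nlinarith
  push_cast
  gcongr
  exact h.le_altCount

/-! ### Sign changes along finite increasing lists. -/

/-- The sum of `w x y` over the consecutive entries `x, y` of a list. -/
def consecutiveSum (w : ℝ → ℝ → ℝ≥0∞) : List ℝ → ℝ≥0∞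
  | [] => 0
  | [_] => 0
  | x :: y :: l => w x y + consecutiveSum w (y :: l)

/-- The indicator of a strict sign change of `g` from `x` to `y`. -/
def signChange (g : ℝ → ℝ) (x y : ℝ) : ℝ≥0∞ := if g x * g y < 0 then 1 else 0

/-- A sign change across `y` must show up on one side of `y`, unless it hides in a zero there. This
is why all sample points below are chosen off the zeros. -/
theorem signChange_triangle {g : ℝ → ℝ} (x z : ℝ) {y : ℝ} (hy : g y ≠ 0) :
    signChange g x z ≤ signChange g x y + signChange g y z := by
  unfold signChange
  split_ifs with h1 h2 h3 h3 <;> simp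
  rcases lt_or_gt_of_ne hy with h | h
  · have a1 : g x ≤ 0 := by
      by_contra hc
      exact h2 (mul_neg_of_pos_of_neg (not_le.1 hc) h)
    have a2 : g z ≤ 0 := by
      by_contra hc
      exact h3 (mul_neg_of_neg_of_pos h (not_le.1 hc))
    nlinarith [mul_nonneg_of_nonpos_of_nonpos a1 a2]
  · have a1 : 0 ≤ g x := by
      by_contra hc
      exact h2 (mul_neg_of_neg_of_pos (not_le.1 hc) h)
    have a2 : 0 ≤ g z := by
      by_contra hc
      exact h3 (mul_neg_of_pos_of_neg h (not_le.1 hc))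
    nlinarith [mul_nonneg a1 a2]

theorem consecutiveSum_add_le {w w₁ w₂ : ℝ → ℝ → ℝ≥0∞} : ∀ {l : List ℝ}, l.SortedLT →
    (∀ x ∈ l, ∀ y ∈ l, x < y → w x y ≤ w₁ x y + w₂ x y) →
    consecutiveSum w l ≤ consecutiveSum w₁ l + consecutiveSum w₂ l
  | [], _, _ => by simp [consecutiveSum]
  | [_], _, _ => by simp [consecutiveSum]
  | x :: y :: l, hl, h => by
    have hp := hl.pairwise
    rw [List.pairwise_cons] at hp
    have ih := consecutiveSum_add_le (l := y :: l) hp.2.sortedLT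
      (fun u hu v hv => h u (List.mem_cons_of_mem _ hu) v (List.mem_cons_of_mem _ hv))
    have h1 := h x (by simp) y (by simp) (hp.1 y (by simp))
    simp only [consecutiveSum]
    calc _ ≤ (w₁ x y + w₂ x y) + (consecutiveSum w₁ (y :: l) + consecutiveSum w₂ (y :: l)) :=
          add_le_add h1 ih
      _ = _ := by ring

theorem consecutiveSum_gap_le {C b : ℝ} (hC : 0 ≤ C) : ∀ {l : List ℝ} {a : ℝ}, a ≤ b →
    l.SortedLT → (∀ x ∈ l, a ≤ x ∧ x ≤ b) →
    consecutiveSum (fun x y => ENNReal.ofReal (C * (y - x))) l ≤ ENNReal.ofReal (C * (b - a))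
  | [], _, _, _, _ => by simp [consecutiveSum]
  | [_], _, _, _, _ => by simp [consecutiveSum]
  | x :: y :: l, a, hab, hl, h => by
    have hp := hl.pairwise
    rw [List.pairwise_cons] at hp
    have hyb := (h y (by simp)).2
    have hxy := hp.1 y (by simp)
    have hax := (h x (by simp)).1
    have ih := consecutiveSum_gap_le (l := y :: l) (a := y) hC hyb hp.2.sortedLT (by
      intro u hu
      refine ⟨?_, (h u (List.mem_cons_of_mem _ hu)).2⟩
      rcases List.mem_cons.1 hu with rfl | hu
      · exact le_rfl
      · exact ((List.pairwise_cons.1 hp.2).1 u hu).le)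
    simp only [consecutiveSum]
    refine (add_le_add le_rfl ih).trans ?_
    rw [← ENNReal.ofReal_add (mul_nonneg hC (by linarith)) (mul_nonneg hC (by linarith))]
    apply ENNReal.ofReal_le_ofReal
    nlinarith

theorem lintegral_consecutiveSum {α : Type*} [MeasurableSpace α] {μ : Measure α}
    {w : α → ℝ → ℝ → ℝ≥0∞} (hw : ∀ x y, Measurable fun θ => w θ x y) : ∀ l : List ℝ,
    (Measurable fun θ => consecutiveSum (w θ) l) ∧
    ∫⁻ θ, consecutiveSum (w θ) l ∂μ = consecutiveSum (fun x y => ∫⁻ θ, w θ x y ∂μ) l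
  | [] => by simp [consecutiveSum]
  | [_] => by simp [consecutiveSum]
  | x :: y :: l => by
    obtain ⟨h1, h2⟩ := lintegral_consecutiveSum (μ := μ) hw (y :: l)
    simp only [consecutiveSum]
    exact ⟨(hw x y).add h1, by rw [lintegral_add_left (hw x y), h2]⟩

theorem consecutiveSum_signChange_le {g : ℝ → ℝ} {a b : ℝ} {l : List ℝ} (hl : l.SortedLT)
    (hab : ∀ x ∈ l, x ∈ Ioo a b) (h0 : ∀ x ∈ l, g x ≠ 0) :
    consecutiveSum (signChange g) l ≤ altCount g a b := by
  -- The induction carries an alternation that starts with the sign of the head, so that a new head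
  -- either extends it or is absorbed.
  have key : ∀ (l : List ℝ) (z : ℝ), (z :: l).SortedLT → (∀ x ∈ z :: l, x ∈ Ioo a b) →
      (∀ x ∈ z :: l, g x ≠ 0) → ∃ p x, Alternates g a b p x ∧ z ≤ x 0 ∧ 0 < g z * g (x 0) ∧
        consecutiveSum (signChange g) (z :: l) ≤ p := by
    intro l
    induction l with
    | nil =>
      intro z _ hab h0
      refine ⟨0, fun _ => z, ⟨fun i _ => hab z (by simp), fun i hi => absurd hi (by simp)⟩, le_rfl,
        mul_self_pos.2 (h0 z (by simp)), by simp [consecutiveSum]⟩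
    | cons y l ih =>
      intro z hl hab h0
      have hp := List.pairwise_cons.1 hl.pairwise
      have hzy := hp.1 y (by simp)
      obtain ⟨p, x, hx, hyx, hs, hle⟩ := ih y hp.2.sortedLT
        (fun u hu => hab u (List.mem_cons_of_mem _ hu))
        (fun u hu => h0 u (List.mem_cons_of_mem _ hu))
      simp only [consecutiveSum]
      by_cases hc : g z * g y < 0
      · refine ⟨p + 1, fun i => Nat.casesOn i z x, ⟨?_, ?_⟩, le_rfl,
          mul_self_pos.2 (h0 z (by simp)), ?_⟩
        · rintro (_ | i) hi
          · exact hab z (by simp)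
          · exact hx.1 i (by omega)
        · rintro (_ | i) hi
          · refine ⟨hzy.trans_le hyx, ?_⟩
            change g z * g (x 0) < 0
            have : (g z * g (x 0)) * (g y * g y) < 0 := by nlinarith
            by_contra hn
            exact absurd this (not_lt.2 (mul_nonneg (not_lt.1 hn) (mul_self_nonneg _)))
          · exact hx.2 i (by omega)
        · rw [signChange, if_pos hc, add_comm]
          push_cast
          gcongr
      · refine ⟨p, x, hx, hzy.le.trans hyx, ?_, ?_⟩
        · have h1 : 0 < g z * g y := lt_of_le_of_ne (not_lt.1 hc)
            (mul_ne_zero (h0 z (by simp)) (h0 y (by simp))).symm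
          have h2 : 0 < (g z * g (x 0)) * (g y * g y) := by nlinarith [mul_pos h1 hs]
          exact pos_of_mul_pos_left h2 (mul_self_nonneg _)
        · rw [signChange, if_neg hc, zero_add]
          exact hle
  cases l with
  | nil => simp [consecutiveSum]
  | cons z l =>
    obtain ⟨p, x, hx, -, -, hle⟩ := key l z hl hab h0
    exact hle.trans hx.le_altCount

/-- Inserting further points at which `g` does not vanish cannot lose sign changes, by
`signChange_triangle`. -/
theorem Alternates.le_consecutiveSum {g : ℝ → ℝ} {a b : ℝ} {p : ℕ} {x : ℕ → ℝ}
    (hx : Alternates g a b p x) {l : List ℝ} (hl : l.SortedLT) (h0 : ∀ y ∈ l, g y ≠ 0)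
    (hmem : ∀ i ≤ p, x i ∈ l) : (p : ℝ≥0∞) ≤ consecutiveSum (signChange g) l := by
  -- The extra term records a possible sign change between the head of the list and the first
  -- alternation point, which may come later.
  have key : ∀ (l : List ℝ) (z : ℝ) (p : ℕ) (x : ℕ → ℝ), (z :: l).SortedLT →
      (∀ y ∈ z :: l, g y ≠ 0) → Alternates g a b p x → (∀ i ≤ p, x i ∈ z :: l) →
      (p : ℝ≥0∞) + signChange g z (x 0) ≤ consecutiveSum (signChange g) (z :: l) := by
    intro l
    induction l with
    | nil =>
      intro z p x hl h0 hx hm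
      have hz : x 0 = z := by simpa using hm 0 (Nat.zero_le _)
      have hp : p = 0 := by
        by_contra hp
        have h1 : x 1 = z := by simpa using hm 1 (by omega)
        have := (hx.2 0 (by omega)).1
        rw [zero_add, h1, hz] at this
        exact lt_irrefl _ this
      subst hp
      simp [consecutiveSum, signChange, hz, mul_self_nonneg]
    | cons y l ih =>
      intro z p x hl h0 hx hm
      have hp := List.pairwise_cons.1 hl.pairwise
      have h0' : ∀ u ∈ y :: l, g u ≠ 0 := fun u hu => h0 u (List.mem_cons_of_mem _ hu)
      have hmono : ∀ i, i ≤ p → x 0 ≤ x i := by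
        intro i
        induction i with
        | zero => intro _; exact le_rfl
        | succ i ihi => intro hi; exact (ihi (by omega)).trans (hx.2 i (by omega)).1.le
      have hzy := h0' y (by simp)
      simp only [consecutiveSum]
      by_cases hz : x 0 = z
      · have hs : signChange g z (x 0) = 0 := by simp [signChange, hz, mul_self_nonneg]
        rw [hs, add_zero]
        obtain _ | p := p
        · simp
        have hx' : Alternates g a b p (fun i => x (i + 1)) :=
          ⟨fun i hi => hx.1 (i + 1) (by omega), fun i hi => hx.2 (i + 1) (by omega)⟩
        have h1 := ih y p (fun i => x (i + 1)) hp.2.sortedLT h0' hx' (by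
          intro i hi
          refine (List.mem_cons.1 (hm (i + 1) (by omega))).resolve_left fun h => ?_
          have h2 := (hx.2 0 (by omega)).1
          have h3 : x 1 ≤ x (i + 1) := by
            clear h
            induction i with
            | zero => exact le_rfl
            | succ i ihi => exact (ihi (by omega)).trans (hx.2 (i + 1) (by omega)).1.le
          rw [zero_add] at h2
          linarith)
        have h2 : signChange g z (x 1) = 1 := by
          rw [signChange, if_pos]
          have := (hx.2 0 (by omega)).2
          rwa [hz] at this
        have h3 := signChange_triangle z (x 1) hzy
        rw [h2] at h3
        push_cast
        calc (p : ℝ≥0∞) + 1 ≤ p + (signChange g z y + signChange g y (x 1)) := by gcongr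
          _ = signChange g z y + (p + signChange g y (x 1)) := by ring
          _ ≤ _ := by gcongr
      · have hz' : z < x 0 := by
          rcases List.mem_cons.1 (hm 0 (Nat.zero_le _)) with h | h
          · exact absurd h hz
          · exact hp.1 _ h
        have h1 := ih y p x hp.2.sortedLT h0' hx (by
          intro i hi
          refine (List.mem_cons.1 (hm i hi)).resolve_left fun h => ?_
          have := hmono i hi
          linarith)
        calc (p : ℝ≥0∞) + signChange g z (x 0)
            ≤ p + (signChange g z y + signChange g y (x 0)) := by
              gcongr; exact signChange_triangle z (x 0) hzy
          _ = signChange g z y + (p + signChange g y (x 0)) := by ring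
          _ ≤ _ := by gcongr
  cases l with
  | nil => simpa using hmem 0 (Nat.zero_le _)
  | cons z l => exact le_self_add.trans (key l z p x hl h0 hx hmem)

theorem Alternates.ne_zero {g : ℝ → ℝ} {a b : ℝ} {p : ℕ} {x : ℕ → ℝ}
    (hx : Alternates g a b p x) (hp : p ≠ 0) {i : ℕ} (hi : i ≤ p) : g (x i) ≠ 0 := by
  intro h
  obtain _ | i := i
  · have := (hx.2 0 (by omega)).2
    simp [h] at this
  · have := (hx.2 i (by omega)).2
    simp [h] at this

/-- The points at which a continuous function alternates may be moved into any set that is dense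
in the part of the interval where the function does not vanish. -/
theorem Alternates.exists_mem {g : ℝ → ℝ} (hg : Continuous g) {a b : ℝ} {p : ℕ} {x : ℕ → ℝ}
    (hx : Alternates g a b p x) (hp : p ≠ 0) {D : Set ℝ}
    (hD : ∀ y ∈ Ioo a b, g y ≠ 0 → y ∈ closure D) :
    ∃ u, Alternates g a b p u ∧ ∀ i ≤ p, u i ∈ D := by
  -- Each point moves only to the right and stays before its successor, or before `b` for the last
  -- one; this preserves the order.
  let nxt : ℕ → ℝ := fun i => if i < p then x (i + 1) else b
  have hnxt : ∀ i ≤ p, x i < nxt i ∧ nxt i ≤ b := by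
    intro i hi
    by_cases h : i < p
    · simp only [nxt, if_pos h]
      exact ⟨(hx.2 i h).1, (hx.1 (i + 1) h).2.le⟩
    · simp only [nxt, if_neg h]
      exact ⟨(hx.1 i hi).2, le_rfl⟩
  have hex : ∀ i, ∃ u, i ≤ p → u ∈ D ∧ x i < u ∧ u < nxt i ∧ 0 < g u * g (x i) := by
    intro i
    by_cases hi : i ≤ p
    swap
    · exact ⟨0, fun h => absurd h hi⟩
    let O : Set ℝ := {y | 0 < g y * g (x i)}
    have hO : IsOpen O := isOpen_lt continuous_const (by fun_prop)
    have hxO : O ∈ 𝓝 (x i) := hO.mem_nhds (mul_self_pos.2 (hx.ne_zero hp hi))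
    have h1 : ∀ᶠ y in 𝓝[>] (x i), y ∈ O ∧ y ∈ Ioo (x i) (nxt i) :=
      Filter.Eventually.and (nhdsWithin_le_nhds hxO) (Ioo_mem_nhdsGT (hnxt i hi).1)
    obtain ⟨y, hyO, hy⟩ := h1.exists
    have hyD : y ∈ closure D := by
      refine hD y ⟨(hx.1 i hi).1.trans hy.1, hy.2.trans_le (hnxt i hi).2⟩ fun h => ?_
      have : (0 : ℝ) < g y * g (x i) := hyO
      simp [h] at this
    obtain ⟨u, ⟨huO, hu⟩, huD⟩ := mem_closure_iff.1 hyD (O ∩ Ioo (x i) (nxt i))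
      (hO.inter isOpen_Ioo) ⟨hyO, hy⟩
    exact ⟨u, fun _ => ⟨huD, hu.1, hu.2, huO⟩⟩
  choose u hu using hex
  refine ⟨u, ⟨fun i hi => ?_, fun i hi => ?_⟩, fun i hi => (hu i hi).1⟩
  · exact ⟨(hx.1 i hi).1.trans (hu i hi).2.1, (hu i hi).2.2.1.trans_le (hnxt i hi).2⟩
  · obtain ⟨-, -, h2, h3⟩ := hu i hi.le
    obtain ⟨-, k1, -, k3⟩ := hu (i + 1) hi
    simp only [nxt, if_pos hi] at h2
    refine ⟨h2.trans k1, ?_⟩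
    have h4 := (hx.2 i hi).2
    have h5 := mul_pos h3 k3
    by_contra hc
    nlinarith [mul_nonneg (not_lt.1 hc) (neg_pos.2 h4).le]

/-! ### Projections to a rotating line. -/

/-- The real part of `z` after a rotation by the angle `-θ`, measured in turns. -/
def proj (θ : UnitAddCircle) (z : ℂ) : ℝ := ((AddCircle.toCircle (-θ) : ℂ) * z).re

theorem proj_coe (t : ℝ) (z : ℂ) :
    proj t z = ‖z‖ * Real.cos (2 * Real.pi * t - Complex.arg z) := by
  have h1 : ((AddCircle.toCircle (-(t : UnitAddCircle)) : Circle) : ℂ) =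
      Complex.exp (((-(2 * Real.pi * t) : ℝ) : ℂ) * Complex.I) := by
    rw [← AddCircle.coe_neg, AddCircle.toCircle_apply_mk, Circle.coe_exp]
    congr 2
    push_cast
    ring
  have h2 : ((AddCircle.toCircle (-(t : UnitAddCircle)) : Circle) : ℂ) * z =
      ((‖z‖ : ℝ) : ℂ) * Complex.exp (((-(2 * Real.pi * t) + Complex.arg z : ℝ) : ℂ) *
        Complex.I) := by
    conv_lhs => rw [h1, ← Complex.norm_mul_exp_arg_mul_I z]
    rw [mul_left_comm, ← Complex.exp_add]
    congr 2
    push_cast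
    ring
  rw [proj, h2, Complex.re_ofReal_mul, Complex.exp_ofReal_mul_I_re, ← Real.cos_neg]
  congr 2
  ring

theorem proj_rotate (θ : UnitAddCircle) (t : ℝ) (z : ℂ) :
    proj θ (Complex.exp (-2 * Real.pi * Complex.I * t) * z) = proj (θ + t) z := by
  have h1 : ((AddCircle.toCircle (-(t : UnitAddCircle)) : Circle) : ℂ) =
      Complex.exp (-2 * Real.pi * Complex.I * t) := by
    rw [← AddCircle.coe_neg, AddCircle.toCircle_apply_mk, Circle.coe_exp]
    congr 1
    push_cast
    ring
  rw [proj, proj, neg_add, AddCircle.toCircle_add, Circle.coe_mul, h1,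
    mul_assoc (AddCircle.toCircle (-θ) : ℂ)]

theorem continuous_proj : Continuous fun q : UnitAddCircle × ℂ => proj q.1 q.2 := by
  unfold proj
  fun_prop

/-- As a function of `θ` the projection is a cosine with two zeros per turn. Its sign can differ
from the one a distance `δ` earlier only within `δ` after a zero. -/
theorem volume_proj_mul_proj_sub_nonpos_le {w : ℂ} (hw : w ≠ 0) {δ : ℝ} (hδ : 0 ≤ δ) :
    volume {θ : UnitAddCircle | proj θ w * proj (θ - δ) w ≤ 0} ≤ ENNReal.ofReal (2 * δ) := by
  have hπ := Real.pi_pos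
  by_cases hδ2 : 1 / 2 ≤ δ
  · calc volume {θ : UnitAddCircle | proj θ w * proj (θ - δ) w ≤ 0}
        ≤ volume (univ : Set UnitAddCircle) := measure_mono (subset_univ _)
      _ = ENNReal.ofReal 1 := by simp
      _ ≤ _ := ENNReal.ofReal_le_ofReal (by linarith)
  have hmeas : MeasurableSet {θ : UnitAddCircle | proj θ w * proj (θ - δ) w ≤ 0} := by
    refine (isClosed_le ?_ continuous_const).measurableSet
    exact (continuous_proj.comp (by fun_prop : Continuous fun θ : UnitAddCircle => (θ, w))).mul
      (continuous_proj.comp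
        (by fun_prop : Continuous fun θ : UnitAddCircle => (θ - (δ : UnitAddCircle), w)))
  let c : ℝ := Complex.arg w / (2 * Real.pi)
  have hc : Complex.arg w = 2 * Real.pi * c := by
    simp only [c]; field_simp
  -- The fundamental domain starts at a zero of the cosine. The other one is `c + 1 / 4`, and the
  -- right end `c + 3 / 4` repeats the first.
  rw [AddCircle.add_projection_respects_measure (T := 1) (c - 1 / 4) hmeas]
  have hsub : (QuotientAddGroup.mk ⁻¹' {θ : UnitAddCircle | proj θ w * proj (θ - δ) w ≤ 0}) ∩
      Ioc (c - 1 / 4) (c - 1 / 4 + 1) ⊆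
      (Icc (c - 1 / 4) (c - 1 / 4 + δ) ∪ Icc (c + 1 / 4) (c + 1 / 4 + δ)) ∪ {c + 3 / 4} := by
    rintro t ⟨ht, ht1, ht2⟩
    change proj (t : UnitAddCircle) w * proj ((t : UnitAddCircle) - (δ : UnitAddCircle)) w ≤ 0 at ht
    rw [← AddCircle.coe_sub, proj_coe, proj_coe, hc] at ht
    by_contra hcon
    simp only [mem_union, mem_Icc, mem_singleton_iff, not_or, not_and_or, not_le] at hcon
    obtain ⟨⟨h1, h2⟩, h3⟩ := hcon
    have h3' : t < c + 3 / 4 := lt_of_le_of_ne (by linarith) h3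
    have hn : 0 < ‖w‖ := norm_pos_iff.2 hw
    have hpos : 0 < Real.cos (2 * Real.pi * t - 2 * Real.pi * c) *
        Real.cos (2 * Real.pi * (t - δ) - 2 * Real.pi * c) := by
      have h1' : c - 1 / 4 + δ < t := h1.resolve_left (by linarith)
      rcases h2 with h2 | h2
      · exact mul_pos (Real.cos_pos_of_mem_Ioo ⟨by nlinarith, by nlinarith⟩)
          (Real.cos_pos_of_mem_Ioo ⟨by nlinarith, by nlinarith⟩)
      · exact mul_pos_of_neg_of_neg
          (Real.cos_neg_of_pi_div_two_lt_of_lt (by nlinarith) (by nlinarith))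
          (Real.cos_neg_of_pi_div_two_lt_of_lt (by nlinarith) (by nlinarith))
    nlinarith [mul_pos (mul_pos hn hn) hpos]
  refine (measure_mono hsub).trans ((measure_union_le _ _).trans ?_)
  rw [Real.volume_singleton, add_zero]
  refine (measure_union_le _ _).trans ?_
  rw [Real.volume_Icc, Real.volume_Icc, ← ENNReal.ofReal_add (by linarith) (by linarith)]
  exact ENNReal.ofReal_le_ofReal (by linarith)

theorem ae_proj_ne_zero {w : ℂ} (hw : w ≠ 0) : ∀ᵐ θ : UnitAddCircle, proj θ w ≠ 0 := by
  rw [ae_iff]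
  have h : volume {θ : UnitAddCircle | ¬ proj θ w ≠ 0} ≤ ENNReal.ofReal (2 * 0) := by
    refine (measure_mono ?_).trans (volume_proj_mul_proj_sub_nonpos_le hw le_rfl)
    intro θ hθ
    have : proj θ w = 0 := not_not.1 hθ
    simp [this]
  simpa using h

theorem measurable_signChange_proj (z w : ℂ) (s t : UnitAddCircle) :
    Measurable fun θ : UnitAddCircle =>
      (if proj (θ + s) z * proj (θ + t) w < 0 then 1 else 0 : ℝ≥0∞) := by
  refine Measurable.ite (isOpen_lt ?_ continuous_const).measurableSet measurable_const
    measurable_const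
  exact (continuous_proj.comp (by fun_prop : Continuous fun θ : UnitAddCircle => (θ + s, z))).mul
    (continuous_proj.comp (by fun_prop : Continuous fun θ : UnitAddCircle => (θ + t, w)))

/-- Translation invariance leaves only a relative rotation of `z` by `t - s`. It can create a sign
change only for directions in which the projection of `z` flips or vanishes. -/
theorem lintegral_signChange_rotate_le {z : ℂ} (hz : z ≠ 0) (w : ℂ) {s t : ℝ} (hst : s ≤ t) :
    ∫⁻ θ : UnitAddCircle, (if proj (θ + s) z * proj (θ + t) w < 0 then 1 else 0 : ℝ≥0∞) ≤
      (∫⁻ θ : UnitAddCircle, (if proj θ z * proj θ w < 0 then 1 else 0 : ℝ≥0∞)) +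
        ENNReal.ofReal (2 * (t - s)) := by
  have h1 : ∫⁻ θ : UnitAddCircle, (if proj (θ + s) z * proj (θ + t) w < 0 then 1 else 0 : ℝ≥0∞) =
      ∫⁻ θ : UnitAddCircle,
        (if proj (θ - ((t - s : ℝ) : UnitAddCircle)) z * proj θ w < 0 then 1 else 0 : ℝ≥0∞) := by
    rw [← lintegral_add_right_eq_self (fun θ : UnitAddCircle => (if proj
      (θ - ((t - s : ℝ) : UnitAddCircle)) z * proj θ w < 0 then 1 else 0 : ℝ≥0∞)) (t : UnitAddCircle)]
    refine lintegral_congr fun θ => ?_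
    have : θ + (t : UnitAddCircle) - ((t - s : ℝ) : UnitAddCircle) = θ + s := by
      rw [AddCircle.coe_sub]; abel
    rw [this]
  let S := {θ : UnitAddCircle | proj θ z * proj (θ - ((t - s : ℝ) : UnitAddCircle)) z ≤ 0}
  rw [h1]
  calc _ ≤ ∫⁻ θ : UnitAddCircle, ((if proj θ z * proj θ w < 0 then 1 else 0 : ℝ≥0∞) +
          S.indicator 1 θ) := by
        refine lintegral_mono fun θ => ?_
        by_cases hS : θ ∈ S
        · rw [indicator_of_mem hS]
          refine le_trans ?_ le_add_self
          split_ifs <;> simp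
        · rw [indicator_of_notMem hS, add_zero]
          have hS' : 0 < proj θ z * proj (θ - ((t - s : ℝ) : UnitAddCircle)) z := not_le.1 hS
          split_ifs with ha hb
          · exact le_rfl
          · exfalso
            nlinarith [mul_nonneg (not_lt.1 hb) hS'.le, mul_self_nonneg (proj θ z),
              mul_neg_of_pos_of_neg (mul_self_pos.2 (left_ne_zero_of_mul hS'.ne')) ha]
          · simp
          · exact le_rfl
    _ = _ := by
        rw [lintegral_add_left (by simpa using measurable_signChange_proj z w 0 0)]
    _ ≤ _ := by
        gcongr
        exact (lintegral_indicator_one_le S).trans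
          (volume_proj_mul_proj_sub_nonpos_le hz (by linarith))

/-! ### The mean number of sign changes of a plane curve. -/

/-- The number of sign changes on `(a, b)` of the projection of the curve `f` to a line through
the origin, averaged over all directions of the line. -/
def meanAlt (f : ℝ → ℂ) (a b : ℝ) : ℝ≥0∞ :=
  ∫⁻ θ : UnitAddCircle, altCount (fun x => proj θ (f x)) a b

theorem meanAlt_const (c : ℂ) (a b : ℝ) : meanAlt (fun _ => c) a b = 0 := by
  simp [meanAlt, altCount_const]

theorem hasDerivAt_proj (θ : UnitAddCircle) {f : ℝ → ℂ} {f' : ℂ} {x : ℝ}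
    (hf : HasDerivAt f f' x) : HasDerivAt (fun x => proj θ (f x)) (proj θ f') x :=
  (Complex.reCLM.hasFDerivAt.comp_hasDerivAt x
    (hf.const_mul ((AddCircle.toCircle (-θ) : Circle) : ℂ)) :)

theorem meanAlt_le_meanAlt_deriv {f f' : ℝ → ℂ} (hf : ∀ x, HasDerivAt f (f' x) x) (a b : ℝ) :
    meanAlt f a b ≤ meanAlt f' a b + 1 := by
  calc meanAlt f a b
      ≤ ∫⁻ θ : UnitAddCircle, (altCount (fun x => proj θ (f' x)) a b + 1) :=
        lintegral_mono fun θ => altCount_le_altCount_deriv (fun x => hasDerivAt_proj θ (hf x)) a b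
    _ = meanAlt f' a b + 1 := by
        rw [lintegral_add_right _ measurable_const, lintegral_one, UnitAddCircle.measure_univ]
        rfl

/-- Sign changes on an interval are seen on large finite parts of a dense sequence. -/
theorem altCount_le_liminf {g : ℝ → ℝ} (hg : Continuous g) {a b : ℝ} {d : ℕ → ℝ}
    (hd : ∀ k, g (d k) ≠ 0) (hdense : ∀ y ∈ Ioo a b, g y ≠ 0 → y ∈ closure (range d)) :
    altCount g a b ≤ liminf (fun m => consecutiveSum (signChange g)
      (((Finset.range m).image d).sort)) atTop := by
  refine altCount_le fun p x hx => ?_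
  rcases eq_or_ne p 0 with rfl | hp
  · simp
  obtain ⟨u, hu, huD⟩ := hx.exists_mem hg hp (D := range d) hdense
  choose! k hk using huD
  refine le_liminf_of_le (by isBoundedDefault) ?_
  filter_upwards [eventually_gt_atTop ((Finset.range (p + 1)).sup k)] with m hm
  refine hu.le_consecutiveSum (Finset.sortedLT_sort _) ?_ ?_
  · intro y hy
    simp only [Finset.mem_sort, Finset.mem_image] at hy
    obtain ⟨j, -, rfl⟩ := hy
    exact hd j
  · intro i hi
    simp only [Finset.mem_sort, Finset.mem_image, Finset.mem_range]
    exact ⟨k i, (Finset.le_sup (f := k) (Finset.mem_range.2 (by omega))).trans_lt hm, hk i hi⟩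

/-- Fatou's lemma along finite parts of `d` reduces the mean to finite sums. These are measurable in
`θ`, so no measurability of the uncountable supremum `altCount` is needed. -/
theorem meanAlt_le_of_dense {f : ℝ → ℂ} (hf : Continuous f) {a b : ℝ} {d : ℕ → ℝ}
    (hd : ∀ k, f (d k) ≠ 0) (hdense : ∀ y ∈ Ioo a b, f y ≠ 0 → y ∈ closure (range d)) {N : ℝ≥0∞}
    (hN : ∀ m, ∫⁻ θ : UnitAddCircle, consecutiveSum (signChange fun x => proj θ (f x))
      (((Finset.range m).image d).sort) ≤ N) : meanAlt f a b ≤ N := by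
  have hmeas : ∀ m, Measurable fun θ : UnitAddCircle =>
      consecutiveSum (signChange fun x => proj θ (f x)) (((Finset.range m).image d).sort) :=
    fun m => (lintegral_consecutiveSum (μ := volume) (fun x y => by
      simpa [signChange] using measurable_signChange_proj (f x) (f y) 0 0) _).1
  have hae : ∀ᵐ θ : UnitAddCircle, ∀ k, proj θ (f (d k)) ≠ 0 :=
    ae_all_iff.2 fun k => ae_proj_ne_zero (hd k)
  have hle : ∀ᵐ θ : UnitAddCircle, altCount (fun x => proj θ (f x)) a b ≤ liminf (fun m =>
      consecutiveSum (signChange fun x => proj θ (f x)) (((Finset.range m).image d).sort))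
        atTop := by
    refine hae.mono fun θ hθ => altCount_le_liminf ?_ hθ fun y hy hy0 => ?_
    · exact continuous_proj.comp (by fun_prop : Continuous fun x => (θ, f x))
    · exact hdense y hy fun h => hy0 (by simp [proj, h])
  refine (lintegral_mono_ae hle).trans ((lintegral_liminf_le hmeas).trans ?_)
  refine liminf_le_of_le (by isBoundedDefault) fun c hc => ?_
  obtain ⟨m, hm⟩ := hc.exists
  exact hm.trans (hN m)

/-- From `x` to `y` the factor turns by `τ(y - x)`, which adds at most `2τ(y - x)` to the mean sign
change of that pair. Along a finite list these gaps sum to at most `2τ(b - a)`, uniformly in the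
list. -/
theorem meanAlt_rotate_le {f : ℝ → ℂ} (hf : Continuous f) {a b : ℝ} (hab : a ≤ b) {τ : ℝ}
    (hτ : 0 ≤ τ) :
    meanAlt (fun x => Complex.exp (-2 * Real.pi * Complex.I * (τ * x : ℝ)) * f x) a b ≤
      meanAlt f a b + ENNReal.ofReal (2 * τ * (b - a)) := by
  obtain ⟨D, hDU, hDc, hUD⟩ := TopologicalSpace.IsSeparable.exists_countable_dense_subset
    (TopologicalSpace.IsSeparable.of_separableSpace {x : ℝ | x ∈ Ioo a b ∧ f x ≠ 0})
  -- If the dense set is empty, `f` vanishes throughout `(a, b)` and no projection alternates.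
  rcases D.eq_empty_or_nonempty with rfl | hne
  · have h0 : meanAlt (fun x => Complex.exp (-2 * Real.pi * Complex.I * (τ * x : ℝ)) * f x) a b
        ≤ 0 := by
      refine (lintegral_mono (g := fun _ => 0) fun θ => altCount_le fun p x hx => ?_).trans
        (by simp)
      rcases eq_or_ne p 0 with rfl | hp
      · simp
      have h1 := hx.ne_zero hp (Nat.zero_le p)
      have h2 : f (x 0) ≠ 0 := fun h => h1 (by simp [proj, h])
      have := hUD ⟨hx.1 0 (Nat.zero_le p), h2⟩
      simp at this
    exact h0.trans zero_le
  obtain ⟨d, rfl⟩ := hDc.exists_eq_range hne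
  have hd : ∀ k, d k ∈ Ioo a b ∧ f (d k) ≠ 0 := fun k => hDU (mem_range_self k)
  refine meanAlt_le_of_dense (by fun_prop) (d := d)
    (fun k => mul_ne_zero (Complex.exp_ne_zero _) (hd k).2)
    (fun y hy hy0 => hUD ⟨hy, right_ne_zero_of_mul hy0⟩) fun m => ?_
  set l := ((Finset.range m).image d).sort with hl
  have hlmem : ∀ y ∈ l, ∃ j, d j = y := by
    intro y hy
    simp only [hl, Finset.mem_sort, Finset.mem_image] at hy
    obtain ⟨j, -, h⟩ := hy
    exact ⟨j, h⟩
  have hsort : l.SortedLT := Finset.sortedLT_sort _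
  have hmeas0 : ∀ x y : ℝ, Measurable fun θ : UnitAddCircle =>
      signChange (fun x => proj θ (f x)) x y := fun x y => by
    simpa [signChange] using measurable_signChange_proj (f x) (f y) 0 0
  have hae : ∀ᵐ θ : UnitAddCircle, ∀ k, proj θ (f (d k)) ≠ 0 :=
    ae_all_iff.2 fun k => ae_proj_ne_zero (hd k).2
  rw [(lintegral_consecutiveSum (fun x y => by
    simpa [signChange] using measurable_signChange_proj _ _ 0 0) l).2]
  refine (consecutiveSum_add_le
    (w₁ := fun x y => ∫⁻ θ : UnitAddCircle, signChange (fun x => proj θ (f x)) x y)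
    (w₂ := fun x y => ENNReal.ofReal (2 * τ * (y - x))) hsort ?_).trans (add_le_add ?_ ?_)
  · intro x hx y _ hxy
    obtain ⟨j, rfl⟩ := hlmem x hx
    have := lintegral_signChange_rotate_le (hd j).2 (f y) (mul_le_mul_of_nonneg_left hxy.le hτ)
    simp only [signChange, proj_rotate]
    convert this using 3
    ring
  · rw [← (lintegral_consecutiveSum hmeas0 l).2]
    refine lintegral_mono_ae (hae.mono fun θ hθ => consecutiveSum_signChange_le hsort ?_ ?_)
    · intro x hx
      obtain ⟨j, rfl⟩ := hlmem x hx
      exact (hd j).1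
    · intro x hx
      obtain ⟨j, rfl⟩ := hlmem x hx
      exact hθ j
  · refine consecutiveSum_gap_le (by positivity) hab hsort fun x hx => ?_
    obtain ⟨j, rfl⟩ := hlmem x hx
    exact ⟨(hd j).1.1.le, (hd j).1.2.le⟩

/-! ### Zeros of a curve and sign changes of its derivative. -/

theorem exists_deriv_pos_and_neg {g g' : ℝ → ℝ} (hg : ∀ x, HasDerivAt g (g' x) x) {u w y : ℝ}
    (hu : g u = 0) (hw : g w = 0) (hy : y ∈ Ioo u w) (hy' : g' y ≠ 0) :
    (∃ ξ ∈ Ioo u w, 0 < g' ξ) ∧ ∃ ξ ∈ Ioo u w, g' ξ < 0 := by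
  have hex : ∃ c ∈ Ioo u w, g c ≠ 0 := by
    by_contra! hc
    refine hy' ((hg y).unique ?_)
    refine (hasDerivAt_const y (0 : ℝ)).congr_of_eventuallyEq ?_
    filter_upwards [Ioo_mem_nhds hy.1 hy.2] with c hc' using hc c hc'
  obtain ⟨c, hc, hc0⟩ := hex
  have hcont : Continuous g := continuous_iff_continuousAt.2 fun x => (hg x).continuousAt
  obtain ⟨ξ, hξ, h1⟩ := exists_hasDerivAt_eq_slope g g' hc.1 hcont.continuousOn (fun x _ => hg x)
  obtain ⟨η, hη, h2⟩ := exists_hasDerivAt_eq_slope g g' hc.2 hcont.continuousOn (fun x _ => hg x)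
  rw [hu, sub_zero] at h1
  rw [hw, zero_sub] at h2
  have hξ' : ξ ∈ Ioo u w := ⟨hξ.1, hξ.2.trans hc.2⟩
  have hη' : η ∈ Ioo u w := ⟨hc.1.trans hη.1, hη.2⟩
  rcases lt_or_gt_of_ne hc0 with h | h
  · exact ⟨⟨η, hη', h2 ▸ div_pos (neg_pos.2 h) (sub_pos.2 hc.2)⟩,
      ⟨ξ, hξ', h1 ▸ div_neg_of_neg_of_pos h (sub_pos.2 hc.1)⟩⟩
  · exact ⟨⟨ξ, hξ', h1 ▸ div_pos h (sub_pos.2 hc.1)⟩,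
      ⟨η, hη', h2 ▸ div_neg_of_neg_of_pos (neg_neg_of_pos h) (sub_pos.2 hc.2)⟩⟩

/-- Between consecutive zeros of a curve the projections of its derivative change their sign. -/
theorem le_meanAlt_deriv_of_zeros {f f' : ℝ → ℂ} (hf : ∀ x, HasDerivAt f (f' x) x) {a b : ℝ}
    {q : ℕ} {z : ℕ → ℝ}
    (hab : ∀ i ≤ q + 1, z i ∈ Icc a b ∧ f (z i) = 0)
    (hne : ∀ i ≤ q, ∃ y ∈ Ioo (z i) (z (i + 1)), f' y ≠ 0) : (q : ℝ≥0∞) ≤ meanAlt f' a b := by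
  choose! y hy hy0 using hne
  -- One witness per gap excludes a null set of directions, so almost every direction works in all
  -- gaps at once.
  have hae : ∀ᵐ θ : UnitAddCircle, ∀ i, i ≤ q → proj θ (f' (y i)) ≠ 0 := by
    refine ae_all_iff.2 fun i => ?_
    by_cases hi : i ≤ q
    · exact (ae_proj_ne_zero (hy0 i hi)).mono fun θ h _ => h
    · exact Eventually.of_forall fun θ h => absurd h hi
  have hle : ∀ᵐ θ : UnitAddCircle, (q : ℝ≥0∞) ≤ altCount (fun x => proj θ (f' x)) a b := by
    refine hae.mono fun θ hθ => ?_
    -- Both signs occur in every gap, so the sign `(-1) ^ i` may be prescribed.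
    have hex : ∀ i ≤ q, ∃ ξ ∈ Ioo (z i) (z (i + 1)), 0 < (-1 : ℝ) ^ i * proj θ (f' ξ) := by
      intro i hi
      obtain ⟨⟨ξ, hξ, h1⟩, η, hη, h2⟩ := exists_deriv_pos_and_neg
        (fun x => hasDerivAt_proj θ (hf x)) (u := z i) (w := z (i + 1))
        (by simp [proj, (hab i (by omega)).2]) (by simp [proj, (hab (i + 1) (by omega)).2])
        (hy i hi) (hθ i hi)
      rcases neg_one_pow_eq_or ℝ i with h | h
      · exact ⟨ξ, hξ, by rw [h]; linarith⟩
      · exact ⟨η, hη, by rw [h]; linarith⟩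
    choose! ξ hξ hs using hex
    refine Alternates.le_altCount (x := ξ) ⟨fun i hi => ?_, fun i hi => ⟨?_, ?_⟩⟩
    · exact ⟨(hab i (by omega)).1.1.trans_lt (hξ i hi).1,
        (hξ i hi).2.trans_le (hab (i + 1) (by omega)).1.2⟩
    · exact (hξ i hi.le).2.trans (hξ (i + 1) hi).1
    · have h1 := hs i hi.le
      have h2 := hs (i + 1) hi
      rw [pow_succ] at h2
      rcases neg_one_pow_eq_or ℝ i with h | h <;> rw [h] at h1 h2
      · exact mul_neg_of_pos_of_neg (by linarith) (by linarith)
      · exact mul_neg_of_neg_of_pos (by linarith) (by linarith)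
  calc (q : ℝ≥0∞) = ∫⁻ _ : UnitAddCircle, (q : ℝ≥0∞) := by simp
    _ ≤ meanAlt f' a b := lintegral_mono_ae hle

/-! ### Exponential sums and their zeros. -/

/-- The exponential sum with the coefficients `d t` and the frequencies `t - m` for `t ∈ T`. -/
def expSum (T : Finset ℝ) (d : ℝ → ℂ) (m x : ℝ) : ℂ :=
  ∑ t ∈ T, d t * Complex.exp (-2 * Real.pi * Complex.I * ((t - m) * x : ℝ))

theorem expSum_shift (T : Finset ℝ) (d : ℝ → ℂ) (a m x : ℝ) :
    expSum T d a x =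
      Complex.exp (-2 * Real.pi * Complex.I * ((m - a) * x : ℝ)) * expSum T d m x := by
  rw [expSum, expSum, Finset.mul_sum]
  refine Finset.sum_congr rfl fun t _ => ?_
  rw [mul_left_comm, ← Complex.exp_add]
  congr 2
  push_cast
  ring

theorem expSum_insert {T : Finset ℝ} (d : ℝ → ℂ) {m : ℝ} (hm : m ∉ T) (x : ℝ) :
    expSum (insert m T) d m x = d m + expSum T d m x := by
  simp [expSum, Finset.sum_insert hm]

theorem hasDerivAt_expSum (T : Finset ℝ) (d : ℝ → ℂ) (m x : ℝ) :
    HasDerivAt (expSum T d m)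
      (expSum T (fun t => -2 * Real.pi * Complex.I * ((t - m : ℝ) : ℂ) * d t) m x) x := by
  unfold expSum
  refine HasDerivAt.fun_sum fun t _ => ?_
  have h1 : HasDerivAt (fun x : ℝ => (((t - m) * x : ℝ) : ℂ)) ((t - m : ℝ) : ℂ) x := by
    simpa using ((hasDerivAt_id x).const_mul (t - m)).ofReal_comp
  exact (((h1.const_mul (-2 * Real.pi * Complex.I)).cexp).const_mul (d t)).congr_deriv (by ring)

theorem hasDerivAt_expSum_insert {T : Finset ℝ} (d : ℝ → ℂ) {m : ℝ} (hm : m ∉ T) (x : ℝ) :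
    HasDerivAt (expSum (insert m T) d m)
      (expSum T (fun t => -2 * Real.pi * Complex.I * ((t - m : ℝ) : ℂ) * d t) m x) x := by
  have h := hasDerivAt_expSum (insert m T) d m x
  rwa [expSum_insert _ hm, sub_self, Complex.ofReal_zero, mul_zero, zero_mul, zero_add] at h

theorem continuous_expSum (T : Finset ℝ) (d : ℝ → ℂ) (m : ℝ) : Continuous (expSum T d m) :=
  continuous_iff_continuousAt.2 fun x => (hasDerivAt_expSum T d m x).continuousAt

theorem deriv_coeff_eq_zero_iff {t m : ℝ} (h : t ≠ m) (c : ℂ) :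
    -2 * Real.pi * Complex.I * ((t - m : ℝ) : ℂ) * c = 0 ↔ c = 0 := by
  have : ((t - m : ℝ) : ℂ) ≠ 0 := Complex.ofReal_ne_zero.2 (sub_ne_zero.2 h)
  rw [mul_eq_zero, or_iff_right]
  exact mul_ne_zero (by simp [Real.pi_ne_zero]) this

/-- Characters are linearly independent on any interval: shifting one frequency to zero and
differentiating removes its term, while the other coefficients are only rescaled by nonzero factors.
-/
theorem coeff_eq_zero_of_expSum_eq_zero {u w : ℝ} (huw : u < w) (T : Finset ℝ) :
    ∀ (d : ℝ → ℂ) (m : ℝ), (∀ x ∈ Ioo u w, expSum T d m x = 0) → ∀ t ∈ T, d t = 0 := by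
  induction T using Finset.induction_on with
  | empty => simp
  | insert s T hs ih =>
    intro d m h
    have h0 : ∀ x ∈ Ioo u w, expSum (insert s T) d s x = 0 := by
      intro x hx
      rw [expSum_shift _ d s m, h x hx, mul_zero]
    have hT : ∀ t ∈ T, d t = 0 := by
      intro t ht
      have := ih (fun t => -2 * Real.pi * Complex.I * ((t - s : ℝ) : ℂ) * d t) s (by
        intro x hx
        refine (hasDerivAt_expSum_insert d hs x).unique ?_
        refine (hasDerivAt_const x (0 : ℂ)).congr_of_eventuallyEq ?_
        filter_upwards [Ioo_mem_nhds hx.1 hx.2] with y hy using h0 y hy) t ht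
      exact (deriv_coeff_eq_zero_iff (ne_of_mem_of_not_mem ht hs) _).1 this
    intro t ht
    rcases Finset.mem_insert.1 ht with rfl | ht
    · have h1 := h0 ((u + w) / 2) ⟨by linarith, by linarith⟩
      rw [expSum_insert d hs, expSum, Finset.sum_eq_zero (fun r hr => by rw [hT r hr, zero_mul]),
        add_zero] at h1
      exact h1
    · exact hT t ht

/-- Induction from the smallest frequency `m`: moving the base point from `A` to `m` costs `2(m -
A)(b - a)`, differentiating costs one, and the remaining frequencies lie in `[m, B]`. A single
frequency leaves a constant, which accounts for the `+ 1`. -/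
theorem meanAlt_expSum_add_one_le {a b B : ℝ} (hab : a ≤ b) (T : Finset ℝ) :
    T.Nonempty → ∀ (d : ℝ → ℂ) (A : ℝ), (∀ t ∈ T, A ≤ t ∧ t ≤ B) →
      meanAlt (expSum T d A) a b + 1 ≤ T.card + ENNReal.ofReal (2 * (B - A) * (b - a)) := by
  induction T using Finset.induction_on_min with
  | empty => simp
  | insert m T hm ih =>
    intro _ d A hT
    have hmT : m ∉ T := fun h => lt_irrefl _ (hm m h)
    obtain ⟨hAm, hmB⟩ := hT m (Finset.mem_insert_self m T)
    have hrot : meanAlt (expSum (insert m T) d A) a b ≤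
        meanAlt (expSum (insert m T) d m) a b + ENNReal.ofReal (2 * (m - A) * (b - a)) := by
      have h := meanAlt_rotate_le (continuous_expSum (insert m T) d m) hab (sub_nonneg.2 hAm)
      simpa only [← expSum_shift (insert m T) d A m] using h
    have hsplit : ENNReal.ofReal (2 * (B - A) * (b - a)) =
        ENNReal.ofReal (2 * (B - m) * (b - a)) + ENNReal.ofReal (2 * (m - A) * (b - a)) := by
      rw [← ENNReal.ofReal_add]
      · congr 1; ring
      · exact mul_nonneg (by linarith) (by linarith)
      · exact mul_nonneg (by linarith) (by linarith)
    rw [Finset.card_insert_of_notMem hmT, hsplit]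
    have hmain : meanAlt (expSum (insert m T) d m) a b ≤
        T.card + ENNReal.ofReal (2 * (B - m) * (b - a)) := by
      rcases T.eq_empty_or_nonempty with rfl | hne
      · have : expSum (insert m ∅) d m = fun _ => d m := by
          funext x
          rw [expSum_insert d hmT]
          simp [expSum]
        rw [this, meanAlt_const]
        exact zero_le
      · exact (meanAlt_le_meanAlt_deriv (hasDerivAt_expSum_insert d hmT) a b).trans
          (ih hne _ m fun t ht => ⟨(hm t ht).le, (hT t (Finset.mem_insert_of_mem ht)).2⟩)
    calc meanAlt (expSum (insert m T) d A) a b + 1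
        ≤ (T.card + ENNReal.ofReal (2 * (B - m) * (b - a))) +
          ENNReal.ofReal (2 * (m - A) * (b - a)) + 1 := by
          gcongr
          exact hrot.trans (by gcongr)
      _ = _ := by push_cast; ring

/-- A non-trivial exponential sum with frequencies in `[A, B]` has at most
`card T + 2 (B - A) (b - a)` zeros in `[a, b]`. -/
theorem card_zeros_expSum_le {a b A B : ℝ} (hab : a ≤ b) {T : Finset ℝ}
    (hT : ∀ t ∈ T, A ≤ t ∧ t ≤ B) {d : ℝ → ℂ} (hd : ∃ t ∈ T, d t ≠ 0) {c : ℝ} {Z : Finset ℝ}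
    (hZ2 : 2 ≤ Z.card) (hZ : ∀ x ∈ Z, x ∈ Icc a b ∧ expSum T d c x = 0) :
    (Z.card : ℝ) ≤ T.card + 2 * (B - A) * (b - a) := by
  obtain ⟨t₀, ht₀, hdt₀⟩ := hd
  have hne : T.Nonempty := ⟨t₀, ht₀⟩
  -- Basing the sum at its least frequency keeps its zeros and makes the derivative lose that term.
  -- The `q + 2` zeros give `q` sign changes of the derivative, and `S` has one element fewer than
  -- `T`, so the offsets cancel.
  set m := T.min' hne with hm_def
  set S := T.erase m with hS
  have hmS : m ∉ S := Finset.notMem_erase m T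
  have hmT : m ∈ T := T.min'_mem hne
  have hins : insert m S = T := Finset.insert_erase hmT
  have hmS' : ∀ t ∈ S, m < t := fun t ht =>
    lt_of_le_of_ne (T.min'_le t (Finset.mem_of_mem_erase ht)) (Finset.ne_of_mem_erase ht).symm
  obtain ⟨q, hq⟩ := Nat.exists_eq_add_of_le' hZ2
  set d' : ℝ → ℂ := fun t => -2 * Real.pi * Complex.I * ((t - m : ℝ) : ℂ) * d t with hd'
  have hder : ∀ x, HasDerivAt (expSum T d m) (expSum S d' m x) x := by
    intro x
    have := hasDerivAt_expSum_insert d hmS x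
    rwa [hins] at this
  let z : ℕ → ℝ := fun i => if h : i < q + 2 then Z.orderEmbOfFin hq ⟨i, h⟩ else 0
  have hz : ∀ i ≤ q, z i < z (i + 1) := by
    intro i hi
    simp only [z, dif_pos (show i < q + 2 by omega), dif_pos (show i + 1 < q + 2 by omega)]
    exact (Z.orderEmbOfFin hq).strictMono (by simp)
  have hzZ : ∀ i ≤ q + 1, z i ∈ Icc a b ∧ expSum T d m (z i) = 0 := by
    intro i hi
    simp only [z, dif_pos (show i < q + 2 by omega)]
    obtain ⟨h1, h2⟩ := hZ _ (Z.orderEmbOfFin_mem hq ⟨i, by omega⟩)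
    exact ⟨h1, by rw [expSum_shift _ d m c, h2, mul_zero]⟩
  have hnz : ∀ i ≤ q, ∃ y ∈ Ioo (z i) (z (i + 1)), expSum S d' m y ≠ 0 := by
    intro i hi
    by_contra! hcon
    have hS0 : ∀ t ∈ S, d t = 0 := fun t ht =>
      (deriv_coeff_eq_zero_iff (hmS' t ht).ne' _).1
        (coeff_eq_zero_of_expSum_eq_zero (hz i hi) S d' m hcon t ht)
    have h0 := (hzZ 0 (by omega)).2
    rw [← hins, expSum_insert d hmS, expSum,
      Finset.sum_eq_zero (fun r hr => by rw [hS0 r hr, zero_mul]), add_zero] at h0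
    rw [← hins] at ht₀
    rcases Finset.mem_insert.1 ht₀ with rfl | h
    · exact hdt₀ h0
    · exact hdt₀ (hS0 _ h)
  have hlow := le_meanAlt_deriv_of_zeros hder hzZ hnz
  have hSne : S.Nonempty := by
    obtain ⟨y, -, hy⟩ := hnz 0 (Nat.zero_le q)
    by_contra hc
    rw [Finset.not_nonempty_iff_eq_empty] at hc
    exact hy (by simp [hc, expSum])
  have hup := meanAlt_expSum_add_one_le (B := B) hab S hSne d' m
    fun t ht => ⟨(hmS' t ht).le, (hT t (Finset.mem_of_mem_erase ht)).2⟩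
  have hmB : m ≤ B := (hT m hmT).2
  have hnn : 0 ≤ 2 * (B - m) * (b - a) := mul_nonneg (by linarith) (by linarith)
  have hfin : ((q + 1 : ℝ)) ≤ S.card + 2 * (B - m) * (b - a) := by
    have h : ENNReal.ofReal (q + 1 : ℝ) ≤ ENNReal.ofReal (S.card + 2 * (B - m) * (b - a)) := by
      rw [ENNReal.ofReal_add (by positivity) zero_le_one,
        ENNReal.ofReal_add (by positivity) hnn, ENNReal.ofReal_natCast, ENNReal.ofReal_natCast,
        ENNReal.ofReal_one]
      exact (add_le_add_left hlow 1).trans hup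
    exact (ENNReal.ofReal_le_ofReal_iff (by positivity)).1 h
  have hcard : (T.card : ℝ) = S.card + 1 := by
    rw [← hins, Finset.card_insert_of_notMem hmS]
    push_cast
    ring
  have hAm : A ≤ m := (hT m hmT).1
  have hmono : 2 * (B - m) * (b - a) ≤ 2 * (B - A) * (b - a) :=
    mul_le_mul_of_nonneg_right (by linarith) (by linarith)
  rw [hq, hcard]
  push_cast
  linarith

/-! ### Injectivity of the sampling map. -/

/-- A finite combination of values of `φ`, with equal arguments collected. -/
theorem sum_smul_eq_sum_fiber {ι M : Type*} [Fintype ι] [AddCommMonoid M] [Module ℂ M]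
    (c : ι → ℂ) (t : ι → ℝ) {T : Finset ℝ} (hT : ∀ j, t j ∈ T) (φ : ℝ → M) :
    ∑ j, c j • φ (t j) = ∑ x ∈ T, (∑ j with t j = x, c j) • φ x := by
  rw [← Finset.sum_fiberwise_of_maps_to (s := Finset.univ) (t := T) (g := t) (fun j _ => hT j)]
  refine Finset.sum_congr rfl fun x _ => ?_
  rw [Finset.sum_smul]
  refine Finset.sum_congr rfl fun j hj => ?_
  rw [(Finset.mem_filter.1 hj).2]

end SparseSampling

end

theorem mainTheorem4 (Λ Ω : ℝ) (hΛ : 0 < Λ) (hΩ : 0 < Ω) (s n : ℕ)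
    (hs : Λ * Ω < 2 * (s : ℝ))
    (hn : (2 + 12 / Real.log (2 * (s : ℝ) / (Λ * Ω))) * (s : ℝ) < (n : ℝ))
    (v : Fin n → ℝ) (hv : Function.Injective v) (hvΩ : ∀ j, v j ∈ Set.Icc (-Ω) Ω) :
    Set.InjOn (SparseSampling.samplingMap v) (SparseSampling.sparseMeasures Λ s) := by
  open SparseSampling in
  rintro μ₁ ⟨c₁, t₁, -, ht₁, rfl⟩ μ₂ ⟨c₂, t₂, -, ht₂, rfl⟩ heq
  set T : Finset ℝ := Finset.univ.image t₁ ∪ Finset.univ.image t₂ with hTdef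
  have hT₁ : ∀ j, t₁ j ∈ T := fun j =>
    Finset.mem_union_left _ (Finset.mem_image_of_mem _ (Finset.mem_univ j))
  have hT₂ : ∀ j, t₂ j ∈ T := fun j =>
    Finset.mem_union_right _ (Finset.mem_image_of_mem _ (Finset.mem_univ j))
  have hTΛ : ∀ t ∈ T, 0 ≤ t ∧ t ≤ Λ := by
    intro t ht
    rcases Finset.mem_union.1 ht with h | h <;> obtain ⟨j, -, rfl⟩ := Finset.mem_image.1 h
    · exact ht₁ j
    · exact ht₂ j
  have hTcard : (T.card : ℝ) ≤ 2 * s := by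
    have h := (Finset.card_union_le (Finset.univ.image t₁) (Finset.univ.image t₂)).trans
      (add_le_add Finset.card_image_le Finset.card_image_le)
    rw [Finset.card_univ, Fintype.card_fin, ← two_mul] at h
    exact_mod_cast h
  -- These are the coefficients of `μ₁ - μ₂` on the joint support, where nodes common to both
  -- measures are merged.
  set d : ℝ → ℂ := fun x => (∑ j with t₁ j = x, c₁ j) - ∑ j with t₂ j = x, c₂ j with hd
  suffices hzero : ∀ t ∈ T, d t = 0 by
    rw [sum_smul_eq_sum_fiber c₁ t₁ hT₁, sum_smul_eq_sum_fiber c₂ t₂ hT₂]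
    exact Finset.sum_congr rfl fun t ht => by rw [sub_eq_zero.1 (hzero t ht)]
  by_contra! hcon
  have hvanish : ∀ j, expSum T d 0 (v j) = 0 := by
    intro j
    have h := congrFun heq j
    change fourierTransform _ (v j) = fourierTransform _ (v j) at h
    rw [fourierTransform_sum_dirac, fourierTransform_sum_dirac] at h
    have h1 := sum_smul_eq_sum_fiber c₁ t₁ hT₁
      (fun t : ℝ => Complex.exp (-2 * Real.pi * Complex.I * (v j) * t))
    have h2 := sum_smul_eq_sum_fiber c₂ t₂ hT₂
      (fun t : ℝ => Complex.exp (-2 * Real.pi * Complex.I * (v j) * t))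
    simp only [smul_eq_mul] at h1 h2
    rw [h1, h2, ← sub_eq_zero, ← Finset.sum_sub_distrib] at h
    rw [← h, expSum]
    refine Finset.sum_congr rfl fun t _ => ?_
    rw [← sub_mul]
    congr 2
    push_cast
    ring
  have hL : 0 < Λ * Ω := mul_pos hΛ hΩ
  have hx : 1 < 2 * (s : ℝ) / (Λ * Ω) := (one_lt_div hL).2 hs
  have hlog : 0 < Real.log (2 * (s : ℝ) / (Λ * Ω)) := Real.log_pos hx
  have hlogle : Real.log (2 * (s : ℝ) / (Λ * Ω)) ≤ 2 * (s : ℝ) / (Λ * Ω) :=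
    (Real.log_le_sub_one_of_pos (by linarith)).trans (by linarith)
  have hspos : 0 < (s : ℝ) := by linarith
  -- With `x = 2s / (ΛΩ)`, the crude bound `log x ≤ x` already makes the right side at least `6ΛΩ`.
  have hbound : 4 * (Λ * Ω) ≤ 12 / Real.log (2 * (s : ℝ) / (Λ * Ω)) * s := by
    rw [div_mul_eq_mul_div, le_div_iff₀ hlog]
    calc 4 * (Λ * Ω) * Real.log (2 * (s : ℝ) / (Λ * Ω))
        ≤ 4 * (Λ * Ω) * (2 * (s : ℝ) / (Λ * Ω)) := by gcongr
      _ = 8 * s := by field_simp; norm_num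
      _ ≤ 12 * s := by linarith
  have hns : 2 * (s : ℝ) + 4 * (Λ * Ω) < n := by nlinarith
  have hn2 : 2 ≤ n := by
    have h1 : 1 ≤ s := by exact_mod_cast hspos
    have h2 : 2 * s < n := by exact_mod_cast (by linarith : 2 * (s : ℝ) < n)
    omega
  have hcard : (Finset.univ.image v).card = n := by
    rw [Finset.card_image_of_injective _ hv, Finset.card_univ, Fintype.card_fin]
  -- The interval lengths `Λ` and `2Ω` turn the zero bound into `2s + 4ΛΩ`, which is less than `n`.
  have hle := card_zeros_expSum_le (a := -Ω) (b := Ω) (by linarith) hTΛ hcon (c := 0)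
    (Z := Finset.univ.image v) (by omega) (by
      intro x hx
      obtain ⟨j, -, rfl⟩ := Finset.mem_image.1 hx
      exact ⟨hvΩ j, hvanish j⟩)
  rw [hcard] at hle
  nlinarith
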